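/- Let $N\ge1$ and let $J:\mathbb R^N\to[0,\infty)$ be a Lévy kernel, i.e. $J$ is nonnegative, radially symmetric, positive near the origin and $\int_{\mathbb R^N}J(z)\,(|z|^2\wedge1)\,dz<\infty$. Put $$m(\xi)=\int_{\mathbb R^N}\bigl(1-\cos(z\cdot\xi)\bigr)J(z)\,dz,\qquad \mathcal E(f,f)=\frac12\int_{\mathbb R^N}\int_{\mathbb R^N}(f(x)-f(y))^2J(x-y)\,dx\,dy .$$ Let $0<\gamma\le2$ and $1<r<s\le2$, and set $$\theta_1=\frac{r[N(2-s)+\gamma s]}{s[N(2-r)+\gamma r]},\qquad \theta_2=\frac{r(2-s)}{s(2-r)} .$$ Suppose that for some $\kappa>0$ the multiplier satisfies $m(\xi)\ge\kappa|\xi|^\gamma$ for all $|\xi|\le1$. Then $\mu:=\inf_{|\xi|\ge1}m(\xi)>0$, and there is a constant $c>0$, depending only on $N,\gamma,r,s,\kappa$ and $\mu$, such that for every real-valued $z\in L^2(\mathbb R^N)\cap L^r(\mathbb R^N)$ with $\mathcal E(z,z)<\infty$, $$\mathcal E(z,z)\ \ge\ c\,\min\left\{\left(\|z\|_s\|z\|_r^{-\theta_1}\right)^{\frac{2}{1-\theta_1}},\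 \left(\|z\|_s\|z\|_r^{-\theta_2}\right)^{\frac{2}{1-\theta_2}}\right\},$$ where the right-hand side is read as $0$ if $z=0$ almost everywhere. -/

import Mathlib

open MeasureTheory
open scoped ENNReal

noncomputable section

/-- Lévy kernels on `ℝ^N`: nonnegative, radially symmetric, positive near the origin, and such that
`∫ J(z) (|z|² ∧ 1) dz < ∞`. Positivity is asked only off the origin, where a singular kernel
such as `|z|^(-N-α)` has no value. Integrability contains the (a.e.) measurability of `J`. -/
structure IsLevyKernel {N : ℕ} (J : EuclideanSpace ℝ (Fin N) → ℝ) : Prop where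
  nonneg : ∀ z, 0 ≤ J z
  radial : ∀ x y, ‖x‖ = ‖y‖ → J x = J y
  pos_near_zero : ∃ δ > 0, ∀ z, z ≠ 0 → ‖z‖ < δ → 0 < J z
  integrable : Integrable (fun z => J z * min (‖z‖ ^ 2) 1) volume

/-- The multiplier (symbol) `m(ξ) = ∫ (1 - cos (z · ξ)) J(z) dz` of the operator with kernel `J`. -/
def multiplier {N : ℕ} (J : EuclideanSpace ℝ (Fin N) → ℝ) (ξ : EuclideanSpace ℝ (Fin N)) : ℝ :=
  ∫ z, (1 - Real.cos (inner ℝ z ξ)) * J z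

/-- The infimum of the multiplier over `|ξ| ≥ 1`. -/
def multiplierInf {N : ℕ} (J : EuclideanSpace ℝ (Fin N) → ℝ) : ℝ :=
  ⨅ ξ : {ξ : EuclideanSpace ℝ (Fin N) // 1 ≤ ‖ξ‖}, multiplier J ξ

/-- The Dirichlet form `E(f,f) = ½ ∬ (f(x) - f(y))² J(x - y) dx dy`, with values in `[0,∞]`. -/
def dirichletForm {N : ℕ} (J f : EuclideanSpace ℝ (Fin N) → ℝ) : ℝ≥0∞ :=
  2⁻¹ * ∫⁻ x, ∫⁻ y, ENNReal.ofReal ((f x - f y) ^ 2 * J (x - y))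

/-- Membership in the energy space `H_L(ℝ^N) = {f ∈ L² : E(f,f) < ∞}`. -/
def MemEnergySpace {N : ℕ} (J f : EuclideanSpace ℝ (Fin N) → ℝ) : Prop :=
  MemLp f 2 volume ∧ dirichletForm J f < ∞

/-- The norm `‖f‖_p` of `L^p(ℝ^N)` for a real exponent `p`, as a real number. -/
def realLpNorm {N : ℕ} (p : ℝ) (f : EuclideanSpace ℝ (Fin N) → ℝ) : ℝ :=
  (eLpNorm f (ENNReal.ofReal p) volume).toReal

/-- `θ₁ = r [N (2 - s) + γ s] / (s [N (2 - r) + γ r])`. -/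
def theta₁ (N : ℕ) (γ r s : ℝ) : ℝ :=
  (r * ((N : ℝ) * (2 - s) + γ * s)) / (s * ((N : ℝ) * (2 - r) + γ * r))

/-- `θ₂ = r (2 - s) / (s (2 - r))`. -/
def theta₂ (r s : ℝ) : ℝ :=
  (r * (2 - s)) / (s * (2 - r))

end

/-! This is Nash's argument with averages over balls. Let `k` be the normalized indicator of the
ball of radius `ε ≥ 1`. Its symbol is at most `min 2 ((ε|ξ|)²/2)`, hence at most `C ε^γ m(ξ)`: for
`|ξ| ≤ 1` by the lower bound on `m` and `γ ≤ 2`, for `|ξ| ≥ 1` by `m ≥ μ`. Plancherel turns this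
into a comparison of the quadratic forms of `k` and `J`. Since `k` has mass one, `‖z‖₂²` is at most
half the form of `k` plus `∬ |z(x)||z(y)| k(x-y)`, and Young's inequality bounds the latter by a
multiple of `ε^(-a) ‖z‖_r²` with `a = N(2/r - 1)`. Thus `‖z‖₂² ≤ c₂ ε^γ E + c₁ ε^(-a) ‖z‖_r²` for
all `ε ≥ 1` (`realLpNorm_two_sq_le`). The balancing `ε` is admissible when `E < ‖z‖_r²`; otherwise
`ε = 1` is used. These two cases yield the two terms of the minimum (`rpow_le_or_le_of_forall`),
after `‖z‖_s` is interpolated between `‖z‖_r` and `‖z‖₂`. Positivity of `μ` comes from the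
Riemann–Lebesgue lemma at infinity and compactness elsewhere. -/

/-! ### Plancherel's theorem for differences -/

open scoped FourierTransform RealInnerProductSpace in
/-- The Fourier transform on `L²` turns translations into modulations. -/
theorem fourier_compMeasurePreserving_sub {E : Type*} [NormedAddCommGroup E]
    [InnerProductSpace ℝ E] [FiniteDimensional ℝ E] [MeasurableSpace E] [BorelSpace E]
    (h : E) (f : Lp ℂ 2 (volume : Measure E)) :
    (𝓕 (Lp.compMeasurePreserving (fun x => x - h) (measurePreserving_sub_right volume h) f) :
      Lp ℂ 2 (volume : Measure E)) =ᵐ[volume] fun ξ => (𝐞 (-⟪h, ξ⟫) : ℂ) * (𝓕 f) ξ := by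
  have hmem : MemLp (fun ξ : E => (𝐞 (-⟪h, ξ⟫) : ℂ)) ∞ volume := by
    refine memLp_top_of_bound (Continuous.aestronglyMeasurable ?_) 1
      (Filter.Eventually.of_forall fun ξ => (Circle.norm_coe _).le)
    exact continuous_subtype_val.comp (Real.continuous_fourierChar.comp (by fun_prop))
  -- With modulation as a bounded operator on `L²`, both sides are continuous in `f`, so Schwartz
  -- functions suffice.
  let M := (ContinuousLinearMap.mul ℂ ℂ).holderL (volume : Measure E) ∞ 2 2 hmem.toLp
  let T := Lp.compMeasurePreservingₗᵢ (E := ℂ) (p := 2) ℂ (fun x : E => x - h)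
    (measurePreserving_sub_right volume h)
  have hM : ∀ g : Lp ℂ 2 (volume : Measure E), M g =ᵐ[volume]
      fun ξ => (𝐞 (-⟪h, ξ⟫) : ℂ) * g ξ := fun g => by
    filter_upwards [(ContinuousLinearMap.mul ℂ ℂ).coeFn_holder (r := 2) hmem.toLp g,
      hmem.coeFn_toLp] with x hx hx'
    simp only [M, ContinuousLinearMap.holderL_apply_apply]
    rw [hx, hx', ContinuousLinearMap.mul_apply']
  suffices key : 𝓕 (T f) = M (𝓕 f) by
    have : 𝓕 (Lp.compMeasurePreserving (fun x => x - h)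
      (measurePreserving_sub_right volume h) f) = M (𝓕 f) := key
    rw [this]
    exact hM _
  refine DenseRange.induction_on (p := fun f => 𝓕 (T f) = M (𝓕 f))
    (SchwartzMap.denseRange_toLpCLM (p := 2) ENNReal.ofNat_ne_top) f ?_ fun g => ?_
  · exact isClosed_eq ((Lp.fourierTransformₗᵢ E ℂ).continuous.comp T.continuous)
      (M.continuous.comp (Lp.fourierTransformₗᵢ E ℂ).continuous)
  · have hT : T (g.toLp 2) = (g.compSubConstCLM ℂ h).toLp 2 := by
      apply Lp.ext
      filter_upwards [Lp.coeFn_compMeasurePreserving (g.toLp 2)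
        (measurePreserving_sub_right volume h), (g.compSubConstCLM ℂ h).coeFn_toLp 2 volume,
        (measurePreserving_sub_right volume h).quasiMeasurePreserving.ae
          (g.coeFn_toLp 2 volume)] with x h1 h2 h3
      rw [h2, SchwartzMap.compSubConstCLM_apply, ← h3]
      exact h1
    simp only [SchwartzMap.toLpCLM_apply]
    rw [hT, SchwartzMap.toLp_fourier_eq, SchwartzMap.toLp_fourier_eq]
    apply Lp.ext
    filter_upwards [hM ((𝓕 g).toLp 2), (𝓕 (g.compSubConstCLM ℂ h)).coeFn_toLp 2 volume,
      (𝓕 g).coeFn_toLp 2 volume] with ξ h1 h2 h3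
    rw [h1, h2, h3, SchwartzMap.fourier_coe, SchwartzMap.fourier_coe]
    have := congrFun (VectorFourier.fourierIntegral_comp_add_right 𝐞 volume (innerₗ E) g (-h)) ξ
    have e : ((g.compSubConstCLM ℂ h : SchwartzMap E ℂ) : E → ℂ) = g ∘ fun v => v + -h := by
      ext v; simp [sub_eq_add_neg]
    rw [e]
    refine this.trans ?_
    simp only [map_neg, LinearMap.neg_apply, innerₗ_apply_apply, Circle.smul_def, smul_eq_mul]
    rfl

theorem norm_one_sub_fourierChar_sq (t : ℝ) :
    ‖1 - (Real.fourierChar (-t) : ℂ)‖ ^ 2 = 2 * (1 - Real.cos (2 * Real.pi * t)) := by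
  rw [Real.fourierChar_apply, ← Complex.normSq_eq_norm_sq, Complex.normSq_apply]
  have e : ((2 * Real.pi * -t : ℝ) : ℂ) * Complex.I = ((-(2 * Real.pi * t) : ℝ) : ℂ) * Complex.I := by
    congr 2; ring
  rw [e, Complex.exp_ofReal_mul_I]
  simp only [Complex.sub_re, Complex.sub_im,
    Complex.add_re, Complex.add_im, Complex.mul_re, Complex.mul_im, Complex.ofReal_re,
    Complex.ofReal_im, Complex.I_re, Complex.I_im, Complex.one_re, Complex.one_im,
    Real.cos_neg, Real.sin_neg]
  nlinarith [Real.sin_sq_add_cos_sq (2 * Real.pi * t)]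

open scoped FourierTransform RealInnerProductSpace in
/-- Plancherel's theorem for the differences of a real function in `L²`. -/
theorem exists_spectral_density {E : Type*} [NormedAddCommGroup E]
    [InnerProductSpace ℝ E] [FiniteDimensional ℝ E] [MeasurableSpace E] [BorelSpace E]
    {z : E → ℝ} (hz : MemLp z 2 volume) :
    ∃ w : E → ℝ≥0∞, Measurable w ∧ ∀ h : E,
      ∫⁻ x, ENNReal.ofReal ((z x - z (x - h)) ^ 2) =
        ∫⁻ ξ, ENNReal.ofReal (2 * (1 - Real.cos (2 * Real.pi * ⟪h, ξ⟫))) * w ξ := by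
  have hzc : MemLp (fun x => (z x : ℂ)) 2 volume := hz.ofReal
  let f : Lp ℂ 2 (volume : Measure E) := hzc.toLp
  refine ⟨fun ξ => ‖(𝓕 f : Lp ℂ 2 (volume : Measure E)) ξ‖ₑ ^ 2,
    (Lp.stronglyMeasurable _).enorm.pow_const _, fun h => ?_⟩
  let Tf := Lp.compMeasurePreserving (fun x => x - h) (measurePreserving_sub_right volume h) f
  have sq : ∀ g : Lp ℂ 2 (volume : Measure E), ‖g‖ₑ ^ 2 = ∫⁻ x, ‖g x‖ₑ ^ 2 := fun g => by
    rw [Lp.enorm_def, eLpNorm_eq_lintegral_rpow_enorm_toReal (by norm_num) (by norm_num)]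
    rw [← ENNReal.rpow_natCast, ← ENNReal.rpow_mul]
    simp
  have h1 : ‖f - Tf‖ₑ = ‖(𝓕 (f - Tf) : Lp ℂ 2 (volume : Measure E))‖ₑ := by
    rw [← ofReal_norm, ← ofReal_norm, Lp.norm_fourier_eq]
  have h2 : ∫⁻ x, ‖(f - Tf) x‖ₑ ^ 2 = ∫⁻ ξ, ‖(𝓕 (f - Tf) : Lp ℂ 2 (volume : Measure E)) ξ‖ₑ ^ 2 := by
    rw [← sq, ← sq, h1]
  have h3 : (𝓕 (f - Tf) : Lp ℂ 2 (volume : Measure E)) = 𝓕 f - 𝓕 Tf :=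
    (Lp.fourierTransformₗᵢ E ℂ).map_sub f Tf
  calc ∫⁻ x, ENNReal.ofReal ((z x - z (x - h)) ^ 2)
      = ∫⁻ x, ‖(f - Tf) x‖ₑ ^ 2 := by
        refine lintegral_congr_ae ?_
        filter_upwards [Lp.coeFn_sub f Tf, hzc.coeFn_toLp,
          (measurePreserving_sub_right volume h).quasiMeasurePreserving.ae hzc.coeFn_toLp,
          Lp.coeFn_compMeasurePreserving f (measurePreserving_sub_right volume h)]
          with x a1 a2 a3 a4
        rw [a1, Pi.sub_apply]
        change _ = ‖f x - Tf x‖ₑ ^ 2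
        rw [show f x = (z x : ℂ) from a2, show Tf x = f (x - h) from a4,
          show f (x - h) = (z (x - h) : ℂ) from a3, ← Complex.ofReal_sub, ← ofReal_norm,
          ← ENNReal.ofReal_pow (norm_nonneg _), Complex.norm_real, Real.norm_eq_abs, sq_abs]
    _ = _ := by
        rw [h2, h3]
        refine lintegral_congr_ae ?_
        filter_upwards [Lp.coeFn_sub (𝓕 f) (𝓕 Tf), fourier_compMeasurePreserving_sub h f]
          with ξ a1 a2
        rw [a1, Pi.sub_apply, a2, ← norm_one_sub_fourierChar_sq,
          ENNReal.ofReal_pow (norm_nonneg _), ofReal_norm, ← mul_pow, ← enorm_mul, sub_mul,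
          one_mul]

/-! ### Positivity and integrability of the multiplier -/

open scoped RealInnerProductSpace in
/-- A nonnegative integrable kernel that is positive near the origin has a multiplier bounded
below by a positive constant away from the origin. -/
theorem exists_pos_le_integral_one_sub_cos {E : Type*} [NormedAddCommGroup E]
    [InnerProductSpace ℝ E] [FiniteDimensional ℝ E] [Nontrivial E] [MeasurableSpace E]
    [BorelSpace E] {K : E → ℝ} (hK : Integrable K) (hK0 : ∀ z, 0 ≤ K z) {δ : ℝ} (hδ : 0 < δ)
    (hpos : ∀ z, z ≠ 0 → ‖z‖ < δ → 0 < K z) :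
    ∃ c > 0, ∀ ξ : E, 1 ≤ ‖ξ‖ → c ≤ ∫ z, (1 - Real.cos ⟪z, ξ⟫) * K z := by
  have hmeas : ∀ ξ : E, AEStronglyMeasurable (fun z => (1 - Real.cos ⟪z, ξ⟫) * K z) volume :=
    fun ξ => (Continuous.aestronglyMeasurable (by fun_prop)).mul hK.1
  have hbound : ∀ ξ z : E, ‖(1 - Real.cos ⟪z, ξ⟫) * K z‖ ≤ 2 * K z := fun ξ z => by
    rw [norm_mul, Real.norm_of_nonneg (hK0 z),
      Real.norm_of_nonneg (by linarith [Real.cos_le_one ⟪z, ξ⟫])]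
    exact mul_le_mul_of_nonneg_right (by linarith [Real.neg_one_le_cos ⟪z, ξ⟫]) (hK0 z)
  have hint : ∀ ξ : E, Integrable (fun z => (1 - Real.cos ⟪z, ξ⟫) * K z) := fun ξ =>
    (hK.const_mul 2).mono' (hmeas ξ) (Filter.Eventually.of_forall (hbound ξ))
  have hnn : ∀ ξ z : E, 0 ≤ (1 - Real.cos ⟪z, ξ⟫) * K z := fun ξ z =>
    mul_nonneg (by linarith [Real.cos_le_one ⟪z, ξ⟫]) (hK0 z)
  have hcont : Continuous fun ξ : E => ∫ z, (1 - Real.cos ⟪z, ξ⟫) * K z :=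
    continuous_of_dominated hmeas (fun ξ => Filter.Eventually.of_forall (hbound ξ))
      (hK.const_mul 2) (Filter.Eventually.of_forall fun z => by fun_prop)
  have hm : ∀ ξ : E, ξ ≠ 0 → 0 < ∫ z, (1 - Real.cos ⟪z, ξ⟫) * K z := fun ξ hξ => by
    rw [integral_pos_iff_support_of_nonneg (hnn ξ) (hint ξ)]
    -- On this open set `0 < ⟪z, ξ⟫ < 1`, so the cosine is below 1 and `z ≠ 0`, and the integrand is
    -- positive.
    let U : Set E := Metric.ball 0 δ ∩ (fun z => ⟪z, ξ⟫) ⁻¹' Set.Ioo 0 1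
    have hU : IsOpen U := Metric.isOpen_ball.inter (isOpen_Ioo.preimage (by fun_prop))
    have hne : U.Nonempty := by
      have hξ' : 0 < ‖ξ‖ := norm_pos_iff.2 hξ
      let t := min (δ / (2 * ‖ξ‖)) (1 / (2 * ‖ξ‖ ^ 2))
      have ht : 0 < t := by positivity
      refine ⟨t • ξ, ?_, ?_, ?_⟩
      · rw [mem_ball_zero_iff, norm_smul, Real.norm_of_nonneg ht.le]
        calc t * ‖ξ‖ ≤ δ / (2 * ‖ξ‖) * ‖ξ‖ := by gcongr; exact min_le_left _ _
          _ = δ / 2 := by field_simp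
          _ < δ := by linarith
      · change 0 < ⟪t • ξ, ξ⟫
        rw [real_inner_smul_left, real_inner_self_eq_norm_sq]; positivity
      · change ⟪t • ξ, ξ⟫ < 1
        rw [real_inner_smul_left, real_inner_self_eq_norm_sq]
        calc t * ‖ξ‖ ^ 2 ≤ 1 / (2 * ‖ξ‖ ^ 2) * ‖ξ‖ ^ 2 := by gcongr; exact min_le_right _ _
          _ = 1 / 2 := by field_simp
          _ < 1 := by norm_num
    refine (hU.measure_pos volume hne).trans_le (measure_mono fun z hz => ?_)
    obtain ⟨hz1, hz2, hz3⟩ := hz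
    have hz0 : z ≠ 0 := by
      rintro rfl
      change 0 < ⟪(0 : E), ξ⟫ at hz2
      simp at hz2
    have hc : Real.cos ⟪z, ξ⟫ < 1 := by
      have := Real.cos_lt_cos_of_nonneg_of_le_pi le_rfl
        (by linarith [Real.pi_gt_three] : ⟪z, ξ⟫ ≤ Real.pi) hz2
      simpa using this
    exact (mul_pos (by linarith) (hpos z hz0 (by simpa using hz1))).ne'
  have hKpos : 0 < ∫ z, K z := by
    obtain ⟨ξ, hξ⟩ := exists_ne (0 : E)
    have h1 := hm ξ hξ
    have h2 : ∫ z, (1 - Real.cos ⟪z, ξ⟫) * K z ≤ ∫ z, 2 * K z :=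
      integral_mono (hint ξ) (hK.const_mul 2) fun z => (le_abs_self _).trans (hbound ξ z)
    rw [integral_const_mul] at h2
    linarith
  have hlim : Filter.Tendsto (fun ξ : E => ∫ z, Real.cos ⟪z, ξ⟫ * K z) (Filter.cocompact E)
      (nhds 0) := by
    -- Riemann–Lebesgue; dilation by `(2π)⁻¹` removes the `2π` from the character.
    have h1 := (tendsto_integral_exp_inner_smul_cocompact (V := E) fun z => (K z : ℂ)).comp
      (Homeomorph.smulOfNeZero ((2 * Real.pi)⁻¹) (by positivity)
        : E ≃ₜ E).isClosedEmbedding.tendsto_cocompact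
    have h2 := (Complex.continuous_re.tendsto 0).comp h1
    refine (h2.congr fun ξ => ?_)
    simp only [Function.comp_apply]
    have hi := (Real.fourierIntegral_convergent_iff (μ := volume) (f := fun z => (K z : ℂ))
      (Homeomorph.smulOfNeZero ((2 * Real.pi)⁻¹) (by positivity) ξ : E)).2 hK.ofReal
    have h3 := integral_re hi
    rw [← RCLike.re_eq_complex_re, ← h3]
    refine integral_congr_ae (Filter.Eventually.of_forall fun z => ?_)
    simp only [Homeomorph.smulOfNeZero_apply, RCLike.re_eq_complex_re, Circle.smul_def,
      smul_eq_mul, Complex.re_mul_ofReal, Real.fourierChar_apply, inner_smul_right]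
    have e : 2 * Real.pi * -((2 * Real.pi)⁻¹ * ⟪z, ξ⟫) = -⟪z, ξ⟫ := by
      field_simp
    rw [e, Complex.exp_ofReal_mul_I_re, Real.cos_neg]
  have hsplit : ∀ ξ : E, ∫ z, (1 - Real.cos ⟪z, ξ⟫) * K z =
      (∫ z, K z) - ∫ z, Real.cos ⟪z, ξ⟫ * K z := fun ξ => by
    rw [← integral_sub hK]
    · simp only [sub_mul, one_mul]
    · refine hK.mono' ((Continuous.aestronglyMeasurable (by fun_prop)).mul hK.1)
        (Filter.Eventually.of_forall fun z => ?_)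
      rw [norm_mul, Real.norm_of_nonneg (hK0 z)]
      exact mul_le_of_le_one_left (hK0 z) (Real.abs_cos_le_one _)
  have hev := hlim.eventually (gt_mem_nhds (half_pos hKpos))
  obtain ⟨S, hS, hSc⟩ := Filter.mem_cocompact.1 hev
  have hSK : IsCompact (S ∩ {ξ | 1 ≤ ‖ξ‖}) :=
    hS.inter_right (isClosed_le continuous_const continuous_norm)
  obtain ⟨c, hc, hcS⟩ : ∃ c > 0, ∀ ξ ∈ S ∩ {ξ | 1 ≤ ‖ξ‖},
      c ≤ ∫ z, (1 - Real.cos ⟪z, ξ⟫) * K z := by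
    rcases (S ∩ {ξ | 1 ≤ ‖ξ‖}).eq_empty_or_nonempty with h | h
    · exact ⟨1, one_pos, by simp [h]⟩
    · obtain ⟨ξ₀, hξ₀, hmin⟩ := hSK.exists_isMinOn h hcont.continuousOn
      refine ⟨_, hm ξ₀ ?_, fun ξ hξ => hmin hξ⟩
      rintro rfl
      have : (1 : ℝ) ≤ ‖(0 : E)‖ := hξ₀.2
      norm_num at this
  refine ⟨min c ((∫ z, K z) / 2), lt_min hc (half_pos hKpos), fun ξ hξ => ?_⟩
  by_cases hξS : ξ ∈ S
  · exact (min_le_left _ _).trans (hcS ξ ⟨hξS, hξ⟩)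
  · have : ∫ z, Real.cos ⟪z, ξ⟫ * K z < (∫ z, K z) / 2 := hSc hξS
    rw [hsplit]
    exact (min_le_right _ _).trans (by linarith)

namespace IsLevyKernel

variable {N : ℕ} {J : EuclideanSpace ℝ (Fin N) → ℝ}

/-- Dividing by the weight recovers `J` off the origin, a null set because `N ≥ 1`. -/
theorem aemeasurable (hJ : IsLevyKernel J) (hN : 1 ≤ N) : AEMeasurable J volume := by
  have : Nonempty (Fin N) := ⟨⟨0, hN⟩⟩
  have h1 : AEMeasurable (fun z => J z * min (‖z‖ ^ 2) 1 * (min (‖z‖ ^ 2) 1)⁻¹) volume :=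
    hJ.integrable.aemeasurable.mul (Measurable.aemeasurable (by fun_prop))
  refine h1.congr ?_
  have h0 : ∀ᵐ z : EuclideanSpace ℝ (Fin N), z ≠ 0 := by
    simp [ae_iff]
  filter_upwards [h0] with z hz
  have : 0 < min (‖z‖ ^ 2) 1 := lt_min (pow_pos (norm_pos_iff.2 hz) 2) one_pos
  field_simp

/-- The bound is `1 - cos t ≤ t²/2` for `|z| ≤ 1` and `1 - cos t ≤ 2` for `|z| ≥ 1`. -/
theorem integrable_one_sub_cos_mul (hJ : IsLevyKernel J) (hN : 1 ≤ N)
    (ξ : EuclideanSpace ℝ (Fin N)) :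
    Integrable (fun z => (1 - Real.cos (inner ℝ z ξ)) * J z) := by
  refine (hJ.integrable.const_mul (max 2 (‖ξ‖ ^ 2 / 2))).mono'
    ((Continuous.aestronglyMeasurable (by fun_prop)).mul
      (hJ.aemeasurable hN).aestronglyMeasurable) (Filter.Eventually.of_forall fun z => ?_)
  have h0 := hJ.nonneg z
  rw [norm_mul, Real.norm_of_nonneg h0,
    Real.norm_of_nonneg (by linarith [Real.cos_le_one (inner ℝ z ξ)]), mul_left_comm,
    mul_comm (J z)]
  refine mul_le_mul_of_nonneg_right ?_ h0
  rcases le_total (‖z‖ ^ 2) 1 with h | h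
  · rw [min_eq_left h]
    have h1 := Real.one_sub_sq_div_two_le_cos (x := inner ℝ z ξ)
    have h2 : (inner ℝ z ξ) ^ 2 ≤ (‖z‖ * ‖ξ‖) ^ 2 := by
      rw [← sq_abs]; gcongr; exact abs_real_inner_le_norm z ξ
    have h3 : ‖ξ‖ ^ 2 / 2 * ‖z‖ ^ 2 ≤ max 2 (‖ξ‖ ^ 2 / 2) * ‖z‖ ^ 2 := by
      gcongr; exact le_max_right _ _
    nlinarith
  · rw [min_eq_right h, mul_one]
    exact le_trans (by linarith [Real.neg_one_le_cos (inner ℝ z ξ)]) (le_max_left _ _)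

/-- `J` may fail to be integrable, so the lower bound is taken from the smaller integrable kernel
`J(z) (|z|² ∧ 1)`. -/
theorem multiplierInf_pos (hJ : IsLevyKernel J) (hN : 1 ≤ N) : 0 < multiplierInf J := by
  have : Nonempty (Fin N) := ⟨⟨0, hN⟩⟩
  obtain ⟨δ, hδ, hpos⟩ := hJ.pos_near_zero
  obtain ⟨c, hc, h⟩ := exists_pos_le_integral_one_sub_cos hJ.integrable
    (fun z => mul_nonneg (hJ.nonneg z) (by positivity)) hδ
    (fun z hz hzδ => mul_pos (hpos z hz hzδ)
      (lt_min (pow_pos (norm_pos_iff.2 hz) 2) one_pos))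
  have : Nonempty {ξ : EuclideanSpace ℝ (Fin N) // 1 ≤ ‖ξ‖} := by
    obtain ⟨ξ, hξ⟩ := exists_norm_eq (EuclideanSpace ℝ (Fin N)) zero_le_one
    exact ⟨⟨ξ, hξ.ge⟩⟩
  refine hc.trans_le (le_ciInf fun ξ => (h ξ ξ.2).trans ?_)
  have hnn : ∀ z, 0 ≤ 1 - Real.cos (inner ℝ z (ξ : EuclideanSpace ℝ (Fin N))) := fun z => by
    linarith [Real.cos_le_one (inner ℝ z (ξ : EuclideanSpace ℝ (Fin N)))]
  refine integral_mono_of_nonneg (Filter.Eventually.of_forall fun z => mul_nonneg (hnn z)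
      (mul_nonneg (hJ.nonneg z) (by positivity))) (hJ.integrable_one_sub_cos_mul hN ξ)
    (Filter.Eventually.of_forall fun z => ?_)
  exact mul_le_mul_of_nonneg_left (mul_le_of_le_one_right (hJ.nonneg z) (min_le_right _ _))
    (hnn z)

theorem multiplier_nonneg (hJ : IsLevyKernel J) (ξ : EuclideanSpace ℝ (Fin N)) :
    0 ≤ multiplier J ξ :=
  integral_nonneg fun z => mul_nonneg
    (by linarith [Real.cos_le_one (inner ℝ z ξ)]) (hJ.nonneg z)

theorem multiplierInf_le (hJ : IsLevyKernel J) {ξ : EuclideanSpace ℝ (Fin N)} (hξ : 1 ≤ ‖ξ‖) :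
    multiplierInf J ≤ multiplier J ξ :=
  ciInf_le (f := fun ξ : {ξ : EuclideanSpace ℝ (Fin N) // 1 ≤ ‖ξ‖} => multiplier J ξ)
    ⟨0, by rintro _ ⟨ξ, rfl⟩; exact hJ.multiplier_nonneg _⟩ ⟨ξ, hξ⟩

end IsLevyKernel

/-! ### Comparison of quadratic forms through their symbols -/

theorem AEMeasurable.comp_sub {E β : Type*} [NormedAddCommGroup E]
    [InnerProductSpace ℝ E] [FiniteDimensional ℝ E] [MeasurableSpace E] [BorelSpace E]
    [MeasurableSpace β] {f : E → β} (hf : AEMeasurable f volume) :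
    AEMeasurable (fun p : E × E => f (p.1 - p.2)) (volume.prod volume) :=
  hf.comp_quasiMeasurePreserving (quasiMeasurePreserving_sub volume volume)

open scoped RealInnerProductSpace in
/-- Spectral representation of all the translation invariant quadratic forms of a fixed real
function in `L²`. -/
theorem exists_spectral_density_energy {E : Type*} [NormedAddCommGroup E]
    [InnerProductSpace ℝ E] [FiniteDimensional ℝ E] [MeasurableSpace E] [BorelSpace E]
    {z : E → ℝ} (hz : MemLp z 2 volume) :
    ∃ w : E → ℝ≥0∞, ∀ j : E → ℝ≥0∞, AEMeasurable j volume →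
      ∫⁻ x, ∫⁻ y, ENNReal.ofReal ((z x - z y) ^ 2) * j (x - y) =
        ∫⁻ ξ, (∫⁻ h, ENNReal.ofReal (2 * (1 - Real.cos (2 * Real.pi * ⟪h, ξ⟫))) * j h) * w ξ := by
  obtain ⟨w, hw, hwz⟩ := exists_spectral_density hz
  have hzm : AEMeasurable z volume := hz.1.aemeasurable
  refine ⟨w, fun j hj => ?_⟩
  have hsub : ∀ h : E, AEMeasurable (fun x => z (x - h)) volume := fun h =>
    hzm.comp_quasiMeasurePreserving (measurePreserving_sub_right volume h).quasiMeasurePreserving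
  calc ∫⁻ x, ∫⁻ y, ENNReal.ofReal ((z x - z y) ^ 2) * j (x - y)
      = ∫⁻ x, ∫⁻ h, ENNReal.ofReal ((z x - z (x - h)) ^ 2) * j h := by
        refine lintegral_congr fun x => ?_
        rw [← lintegral_sub_left_eq_self
          (fun h => ENNReal.ofReal ((z x - z (x - h)) ^ 2) * j h) x]
        simp only [sub_sub_cancel]
    _ = ∫⁻ h, ∫⁻ x, ENNReal.ofReal ((z x - z (x - h)) ^ 2) * j h :=
        lintegral_lintegral_swap
          (((hzm.comp_fst.sub hzm.comp_sub).pow_const 2).ennreal_ofReal.mul hj.comp_snd)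
    _ = ∫⁻ h, ∫⁻ ξ, ENNReal.ofReal (2 * (1 - Real.cos (2 * Real.pi * ⟪h, ξ⟫))) * w ξ * j h := by
        refine lintegral_congr fun h => ?_
        have hd : AEMeasurable (fun x => ENNReal.ofReal ((z x - z (x - h)) ^ 2)) volume :=
          ((hzm.sub (hsub h)).pow_const 2).ennreal_ofReal
        rw [lintegral_mul_const'' _ hd, hwz h, lintegral_mul_const'']
        exact (Measurable.ennreal_ofReal (by fun_prop)).aemeasurable.mul hw.aemeasurable
    _ = ∫⁻ ξ, ∫⁻ h, ENNReal.ofReal (2 * (1 - Real.cos (2 * Real.pi * ⟪h, ξ⟫))) * w ξ * j h := by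
        refine lintegral_lintegral_swap (AEMeasurable.mul (AEMeasurable.mul ?_ ?_) hj.comp_fst)
        · exact (Measurable.ennreal_ofReal (Continuous.measurable (by fun_prop))).aemeasurable
        · exact (hw.comp measurable_snd).aemeasurable
    _ = _ := by
        refine lintegral_congr fun ξ => ?_
        rw [← lintegral_mul_const'']
        · simp only [mul_right_comm]
        · exact (Measurable.ennreal_ofReal (by fun_prop)).aemeasurable.mul hj

open scoped RealInnerProductSpace in
/-- A comparison of multipliers gives a comparison of the quadratic forms. -/
theorem lintegral_sq_sub_mul_le_of_multiplier_le {E : Type*} [NormedAddCommGroup E]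
    [InnerProductSpace ℝ E] [FiniteDimensional ℝ E] [MeasurableSpace E] [BorelSpace E]
    {z : E → ℝ} (hz : MemLp z 2 volume) {j k : E → ℝ≥0∞} (hj : AEMeasurable j volume)
    (hk : AEMeasurable k volume) {C : ℝ≥0∞} (hC : C ≠ ∞)
    (hjk : ∀ ξ : E, ∫⁻ h, ENNReal.ofReal (1 - Real.cos ⟪h, ξ⟫) * k h ≤
      C * ∫⁻ h, ENNReal.ofReal (1 - Real.cos ⟪h, ξ⟫) * j h) :
    ∫⁻ x, ∫⁻ y, ENNReal.ofReal ((z x - z y) ^ 2) * k (x - y) ≤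
      C * ∫⁻ x, ∫⁻ y, ENNReal.ofReal ((z x - z y) ^ 2) * j (x - y) := by
  obtain ⟨w, hw⟩ := exists_spectral_density_energy hz
  rw [hw k hk, hw j hj, ← lintegral_const_mul' _ _ hC]
  refine lintegral_mono fun ξ => ?_
  -- The Fourier normalization carries a `2π`, so the hypothesis is used at the frequency `2πξ`.
  have key : ∀ i : E → ℝ≥0∞,
      ∫⁻ h, ENNReal.ofReal (2 * (1 - Real.cos (2 * Real.pi * ⟪h, ξ⟫))) * i h =
        2 * ∫⁻ h, ENNReal.ofReal (1 - Real.cos ⟪h, (2 * Real.pi) • ξ⟫) * i h := fun i => by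
    rw [← lintegral_const_mul' _ _ (by norm_num)]
    refine lintegral_congr fun h => ?_
    rw [ENNReal.ofReal_mul zero_le_two, inner_smul_right, mul_assoc]
    norm_num
  dsimp only
  rw [key, key, ← mul_assoc]
  refine mul_le_mul_left ?_ _
  calc 2 * ∫⁻ h, ENNReal.ofReal (1 - Real.cos ⟪h, (2 * Real.pi) • ξ⟫) * k h
      ≤ 2 * (C * ∫⁻ h, ENNReal.ofReal (1 - Real.cos ⟪h, (2 * Real.pi) • ξ⟫) * j h) := by
        gcongr; exact hjk _
    _ = _ := by ring

/-! ### Young's inequality and averaging over balls -/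

/-- Young's convolution inequality, as a bound for a bilinear form on `L^r`. -/
theorem lintegral_lintegral_mul_mul_sub_le {E : Type*} [NormedAddCommGroup E]
    [InnerProductSpace ℝ E] [FiniteDimensional ℝ E] [MeasurableSpace E] [BorelSpace E]
    {f k : E → ℝ≥0∞} (hf : AEMeasurable f volume) (hk : AEMeasurable k volume) {r : ℝ}
    (hr1 : 1 < r) (hr2 : r ≤ 2) :
    ∫⁻ x, ∫⁻ y, f x * f y * k (x - y) ≤
      (∫⁻ x, f x ^ r) ^ (2 / r) * (∫⁻ x, k x ^ (r / (2 * (r - 1)))) ^ (2 - 2 / r) := by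
  have hr0 : 0 < r := by linarith
  have hr1' : 0 < r - 1 := by linarith
  -- Three-factor Hölder: `f(x) f(y) k = (f(x)^r f(y)^r)^α (f(x)^r k^t)^β (f(y)^r k^t)^β`, which
  -- forces `r(α + β) = 1` and `2tβ = 1`; then `α + 2β = 1`.
  set t := r / (2 * (r - 1)) with ht
  have ht0 : 0 < t := by positivity
  set α := 2 / r - 1 with hα
  set β := 1 - 1 / r with hβ
  have hα0 : 0 ≤ α := by rw [hα, sub_nonneg, le_div_iff₀ hr0]; linarith
  have hβ0 : 0 ≤ β := by rw [hβ, sub_nonneg, div_le_one hr0]; linarith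
  have h1 : r * α + r * β = 1 := by rw [hα, hβ]; field_simp; ring
  have h2 : t * β + t * β = 1 := by rw [ht, hβ]; field_simp; ring
  have hfr : AEMeasurable (fun x => f x ^ r) volume := hf.pow_const r
  have hkt : AEMeasurable (fun x => k x ^ t) volume := hk.pow_const t
  let F : Fin 3 → E × E → ℝ≥0∞ := ![fun p => f p.1 ^ r * f p.2 ^ r,
    fun p => f p.1 ^ r * k (p.1 - p.2) ^ t, fun p => f p.2 ^ r * k (p.1 - p.2) ^ t]
  let q : Fin 3 → ℝ := ![α, β, β]
  have hF : ∀ i, AEMeasurable (F i) (volume.prod volume) := by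
    intro i
    fin_cases i
    · exact hfr.comp_fst.mul hfr.comp_snd
    · exact hfr.comp_fst.mul hkt.comp_sub
    · exact hfr.comp_snd.mul hkt.comp_sub
  have holder := ENNReal.lintegral_prod_norm_pow_le (μ := volume.prod volume) Finset.univ
    (f := F) (fun i _ => hF i) (p := q)
    (by simp only [q, Fin.sum_univ_three]; simp; rw [hα, hβ]; ring)
    (fun i _ => by fin_cases i <;> simpa [q])
  simp only [Fin.prod_univ_three] at holder
  have I1 : ∫⁻ p, F 0 p ∂(volume.prod volume) = (∫⁻ x, f x ^ r) * ∫⁻ x, f x ^ r :=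
    lintegral_prod_mul hfr hfr
  have I2 : ∫⁻ p, F 1 p ∂(volume.prod volume) = (∫⁻ x, f x ^ r) * ∫⁻ x, k x ^ t := by
    rw [lintegral_prod _ (hF 1), ← lintegral_mul_const'' _ hfr]
    refine lintegral_congr fun x => ?_
    change ∫⁻ y, f x ^ r * k (x - y) ^ t = _
    rw [lintegral_const_mul'', lintegral_sub_left_eq_self (fun y => k y ^ t) x]
    exact hkt.comp_quasiMeasurePreserving (quasiMeasurePreserving_sub_left volume x)
  have I3 : ∫⁻ p, F 2 p ∂(volume.prod volume) = (∫⁻ x, f x ^ r) * ∫⁻ x, k x ^ t := by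
    rw [lintegral_prod_symm _ (hF 2), ← lintegral_mul_const'' _ hfr]
    refine lintegral_congr fun y => ?_
    change ∫⁻ x, f y ^ r * k (x - y) ^ t = _
    rw [lintegral_const_mul'', lintegral_sub_right_eq_self (fun y => k y ^ t) y]
    exact hkt.comp_quasiMeasurePreserving
      (measurePreserving_sub_right volume y).quasiMeasurePreserving
  rw [I1, I2, I3] at holder
  have hfk : AEMeasurable (fun p : E × E => f p.1 * f p.2 * k (p.1 - p.2))
      (volume.prod volume) := (hf.comp_fst.mul hf.comp_snd).mul hk.comp_sub
  rw [← lintegral_prod (fun p : E × E => f p.1 * f p.2 * k (p.1 - p.2)) hfk]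
  calc ∫⁻ p : E × E, f p.1 * f p.2 * k (p.1 - p.2) ∂(volume.prod volume)
      = ∫⁻ p, F 0 p ^ q 0 * F 1 p ^ q 1 * F 2 p ^ q 2 ∂(volume.prod volume) := by
        refine lintegral_congr fun p => ?_
        change _ = (f p.1 ^ r * f p.2 ^ r) ^ α * (f p.1 ^ r * k (p.1 - p.2) ^ t) ^ β *
          (f p.2 ^ r * k (p.1 - p.2) ^ t) ^ β
        simp only [ENNReal.mul_rpow_of_nonneg _ _ hα0, ENNReal.mul_rpow_of_nonneg _ _ hβ0,
          ← ENNReal.rpow_mul]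
        have e : ∀ a : ℝ≥0∞, a = a ^ (r * α) * a ^ (r * β) := fun a => by
          rw [← ENNReal.rpow_add_of_nonneg _ _ (by positivity) (by positivity), h1,
            ENNReal.rpow_one]
        have e' : ∀ a : ℝ≥0∞, a = a ^ (t * β) * a ^ (t * β) := fun a => by
          rw [← ENNReal.rpow_add_of_nonneg _ _ (by positivity) (by positivity), h2,
            ENNReal.rpow_one]
        conv_lhs => rw [e (f p.1), e (f p.2), e' (k (p.1 - p.2))]
        ring
    _ ≤ _ := holder
    _ = _ := by
        change ((∫⁻ x, f x ^ r) * ∫⁻ x, f x ^ r) ^ α * ((∫⁻ x, f x ^ r) * ∫⁻ x, k x ^ t) ^ β *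
          ((∫⁻ x, f x ^ r) * ∫⁻ x, k x ^ t) ^ β = _
        generalize (∫⁻ x, f x ^ r) = A
        generalize (∫⁻ x, k x ^ t) = B
        simp only [ENNReal.mul_rpow_of_nonneg _ _ hα0, ENNReal.mul_rpow_of_nonneg _ _ hβ0]
        have e1 : A ^ (2 / r) = A ^ α * A ^ α * (A ^ β * A ^ β) := by
          simp only [← ENNReal.rpow_add_of_nonneg _ _ hα0 hα0,
            ← ENNReal.rpow_add_of_nonneg _ _ hβ0 hβ0]
          rw [← ENNReal.rpow_add_of_nonneg _ _ (by positivity) (by positivity)]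
          congr 1; rw [hα, hβ]; ring
        have e2 : B ^ (2 - 2 / r) = B ^ β * B ^ β := by
          rw [← ENNReal.rpow_add_of_nonneg _ _ hβ0 hβ0]
          congr 1; rw [hβ]; ring
        rw [e1, e2]; ring

/-- Splitting of the `L²` norm by means of a probability kernel. -/
theorem two_mul_lintegral_sq_le {E : Type*} [NormedAddCommGroup E]
    [InnerProductSpace ℝ E] [FiniteDimensional ℝ E] [MeasurableSpace E] [BorelSpace E]
    {z : E → ℝ} (hz : AEMeasurable z volume) {j : E → ℝ≥0∞} (hj : AEMeasurable j volume)
    (hj1 : ∫⁻ x, j x = 1) :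
    2 * ∫⁻ x, ‖z x‖ₑ ^ 2 ≤ (∫⁻ x, ∫⁻ y, ENNReal.ofReal ((z x - z y) ^ 2) * j (x - y)) +
      2 * ∫⁻ x, ∫⁻ y, ‖z x‖ₑ * ‖z y‖ₑ * j (x - y) := by
  have hsq : AEMeasurable (fun x => ‖z x‖ₑ ^ 2) volume := hz.enorm.pow_const 2
  have m1 : AEMeasurable (fun p : E × E => ‖z p.1‖ₑ ^ 2 * j (p.1 - p.2))
    (volume.prod volume) := hsq.comp_fst.mul hj.comp_sub
  have m2 : AEMeasurable (fun p : E × E => ‖z p.2‖ₑ ^ 2 * j (p.1 - p.2))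
    (volume.prod volume) := hsq.comp_snd.mul hj.comp_sub
  have m3 : AEMeasurable (fun p : E × E => ENNReal.ofReal ((z p.1 - z p.2) ^ 2) * j (p.1 - p.2))
    (volume.prod volume) :=
    ((hz.comp_fst.sub hz.comp_snd).pow_const 2).ennreal_ofReal.mul hj.comp_sub
  have m4 : AEMeasurable (fun p : E × E => ‖z p.1‖ₑ * ‖z p.2‖ₑ * j (p.1 - p.2))
    (volume.prod volume) := (hz.enorm.comp_fst.mul hz.enorm.comp_snd).mul hj.comp_sub
  have i1 : ∫⁻ p, ‖z p.1‖ₑ ^ 2 * j (p.1 - p.2) ∂(volume.prod volume) = ∫⁻ x, ‖z x‖ₑ ^ 2 := by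
    rw [lintegral_prod _ m1]
    refine lintegral_congr fun x => ?_
    dsimp only
    rw [lintegral_const_mul'', lintegral_sub_left_eq_self j x, hj1, mul_one]
    exact hj.comp_quasiMeasurePreserving (quasiMeasurePreserving_sub_left volume x)
  have i2 : ∫⁻ p, ‖z p.2‖ₑ ^ 2 * j (p.1 - p.2) ∂(volume.prod volume) = ∫⁻ x, ‖z x‖ₑ ^ 2 := by
    rw [lintegral_prod_symm _ m2]
    refine lintegral_congr fun y => ?_
    dsimp only
    rw [lintegral_const_mul'', lintegral_sub_right_eq_self j y, hj1, mul_one]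
    exact hj.comp_quasiMeasurePreserving
      (measurePreserving_sub_right volume y).quasiMeasurePreserving
  have i3 := lintegral_prod _ m3
  have i4 := lintegral_prod _ m4
  dsimp only at i3 i4
  rw [← i3, ← i4, ← lintegral_const_mul'' _ m4, ← lintegral_add_left' m3, two_mul]
  -- One copy of `∫ z²` is written through the first variable and the other through the second,
  -- leaving the pointwise bound `a² + b² ≤ (a - b)² + 2|a||b|`.
  nth_rw 1 [← i1]
  rw [← i2, ← lintegral_add_left' m1]
  refine lintegral_mono fun p => ?_
  dsimp only
  rw [← add_mul, ← mul_assoc, ← add_mul]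
  refine mul_le_mul_left ?_ _
  simp only [← ofReal_norm, ← ENNReal.ofReal_pow (norm_nonneg _),
    ← ENNReal.ofReal_mul (norm_nonneg _)]
  rw [← ENNReal.ofReal_add (by positivity) (by positivity),
    show (2 : ℝ≥0∞) = ENNReal.ofReal 2 by simp, ← ENNReal.ofReal_mul zero_le_two,
    ← ENNReal.ofReal_add (by positivity) (by positivity)]
  refine ENNReal.ofReal_le_ofReal ?_
  simp only [Real.norm_eq_abs, sq_abs]
  have := le_abs_self (z p.1 * z p.2)
  rw [abs_mul] at this
  nlinarith

/-- The normalized indicator function of the ball of radius `ε` about the origin. -/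
noncomputable def ballKernel (E : Type*) [NormedAddCommGroup E] [MeasureSpace E] (ε : ℝ) :
    E → ℝ≥0∞ :=
  (Metric.ball 0 ε).indicator fun _ => (volume (Metric.ball (0 : E) ε))⁻¹

section ballKernel

variable {E : Type*} [NormedAddCommGroup E] [InnerProductSpace ℝ E] [FiniteDimensional ℝ E]
  [MeasurableSpace E] [BorelSpace E] {ε : ℝ}

theorem measurable_ballKernel : Measurable (ballKernel E ε) :=
  measurable_const.indicator Metric.isOpen_ball.measurableSet

theorem lintegral_ballKernel (hε : 0 < ε) : ∫⁻ x, ballKernel E ε x = 1 := by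
  rw [ballKernel, lintegral_indicator_const Metric.isOpen_ball.measurableSet,
    ENNReal.inv_mul_cancel (Metric.measure_ball_pos volume 0 hε).ne' measure_ball_lt_top.ne]

/-- For Young's exponent, `1/t = 2 - 2/r`, so this norm decays like `ε^(-N(2/r - 1))`. -/
theorem lintegral_ballKernel_rpow (hε : 0 < ε) {t : ℝ} (ht : 0 < t) :
    (∫⁻ x, ballKernel E ε x ^ t) ^ (1 / t) = volume (Metric.ball (0 : E) ε) ^ (1 / t - 1) := by
  have h0 := (Metric.measure_ball_pos (volume : Measure E) 0 hε).ne'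
  have h1 := (measure_ball_lt_top (μ := (volume : Measure E)) (x := 0) (r := ε)).ne
  have : (fun x => ballKernel E ε x ^ t) =
      (Metric.ball 0 ε).indicator fun _ => (volume (Metric.ball (0 : E) ε))⁻¹ ^ t := by
    ext x
    by_cases hx : x ∈ Metric.ball 0 ε <;> simp [ballKernel, hx, ht]
  rw [this, lintegral_indicator_const Metric.isOpen_ball.measurableSet,
    ENNReal.mul_rpow_of_nonneg _ _ (by positivity), ← ENNReal.rpow_mul, mul_one_div_cancel ht.ne',
    ENNReal.rpow_one, sub_eq_add_neg, ENNReal.rpow_add _ _ h0 h1, ENNReal.rpow_neg_one, mul_comm]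

open scoped RealInnerProductSpace in
theorem lintegral_one_sub_cos_mul_ballKernel_le (hε : 0 < ε) (ξ : E) :
    ∫⁻ h, ENNReal.ofReal (1 - Real.cos ⟪h, ξ⟫) * ballKernel E ε h ≤
      ENNReal.ofReal (min 2 ((ε * ‖ξ‖) ^ 2 / 2)) := by
  calc ∫⁻ h, ENNReal.ofReal (1 - Real.cos ⟪h, ξ⟫) * ballKernel E ε h
      ≤ ∫⁻ h, ENNReal.ofReal (min 2 ((ε * ‖ξ‖) ^ 2 / 2)) * ballKernel E ε h := by
        refine lintegral_mono fun h => ?_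
        by_cases hh : h ∈ Metric.ball 0 ε
        · refine mul_le_mul_left (ENNReal.ofReal_le_ofReal (le_min ?_ ?_)) _
          · linarith [Real.neg_one_le_cos ⟪h, ξ⟫]
          · have h1 := Real.one_sub_sq_div_two_le_cos (x := ⟪h, ξ⟫)
            have h2 : ⟪h, ξ⟫ ^ 2 ≤ (ε * ‖ξ‖) ^ 2 := by
              rw [← sq_abs]
              have := (mem_ball_zero_iff.1 hh).le
              gcongr
              exact (abs_real_inner_le_norm h ξ).trans (by gcongr)
            linarith
        · simp [ballKernel, hh]
    _ = _ := by
        rw [lintegral_const_mul _ measurable_ballKernel, lintegral_ballKernel hε, mul_one]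

end ballKernel

/-! ### Nash-type inequalities for the Dirichlet form -/

section LevyKernel

variable {N : ℕ} {J : EuclideanSpace ℝ (Fin N) → ℝ}

theorem IsLevyKernel.lintegral_one_sub_cos_mul (hJ : IsLevyKernel J) (hN : 1 ≤ N)
    (ξ : EuclideanSpace ℝ (Fin N)) :
    ∫⁻ h, ENNReal.ofReal (1 - Real.cos (inner ℝ h ξ)) * ENNReal.ofReal (J h) =
      ENNReal.ofReal (multiplier J ξ) := by
  have h0 : ∀ h : EuclideanSpace ℝ (Fin N), 0 ≤ 1 - Real.cos (inner ℝ h ξ) := fun h => by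
    linarith [Real.cos_le_one (inner ℝ h ξ)]
  rw [multiplier, ofReal_integral_eq_lintegral_ofReal (hJ.integrable_one_sub_cos_mul hN ξ)
    (Filter.Eventually.of_forall fun h => mul_nonneg (h0 h) (hJ.nonneg h))]
  exact lintegral_congr fun h => (ENNReal.ofReal_mul (h0 h)).symm

/-- For `|ξ| ≤ 1`, `γ ≤ 2` gives `min 2 (t²/2) ≤ 2 t^γ` at `t = ε|ξ|`. For `|ξ| ≥ 1` the bound 2 is
absorbed by `μ`, as `ε^γ ≥ 1`. -/
theorem min_two_sq_le_mul_multiplier (hJ : IsLevyKernel J) {γ κ : ℝ} (hγ₀ : 0 < γ) (hγ₂ : γ ≤ 2)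
    (hκ : 0 < κ) (hμ : 0 < multiplierInf J)
    (hm : ∀ ξ : EuclideanSpace ℝ (Fin N), ‖ξ‖ ≤ 1 → κ * ‖ξ‖ ^ γ ≤ multiplier J ξ)
    {ε : ℝ} (hε : 1 ≤ ε) (ξ : EuclideanSpace ℝ (Fin N)) :
    min 2 ((ε * ‖ξ‖) ^ 2 / 2) ≤ 2 / min κ (multiplierInf J) * ε ^ γ * multiplier J ξ := by
  have hl : 0 < min κ (multiplierInf J) := lt_min hκ hμ
  have hε0 : 0 < ε := by linarith
  have hεγ : 1 ≤ ε ^ γ := Real.one_le_rpow hε hγ₀.le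
  have hm0 := hJ.multiplier_nonneg ξ
  rw [div_mul_eq_mul_div, div_mul_eq_mul_div, le_div_iff₀ hl]
  rcases le_total ‖ξ‖ 1 with h | h
  · have h1 : min 2 ((ε * ‖ξ‖) ^ 2 / 2) ≤ 2 * (ε * ‖ξ‖) ^ γ := by
      rcases le_total (ε * ‖ξ‖) 1 with h' | h'
      · refine (min_le_right _ _).trans ?_
        rcases (norm_nonneg ξ).eq_or_lt with h0 | h0
        · rw [← h0]; simp [hγ₀.ne']
        · have : (ε * ‖ξ‖) ^ (2 : ℝ) ≤ (ε * ‖ξ‖) ^ γ :=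
            Real.rpow_le_rpow_of_exponent_ge (by positivity) h' hγ₂
          rw [Real.rpow_two] at this
          nlinarith [sq_nonneg (ε * ‖ξ‖)]
      · refine (min_le_left _ _).trans ?_
        linarith [Real.one_le_rpow h' hγ₀.le]
    calc min 2 ((ε * ‖ξ‖) ^ 2 / 2) * min κ (multiplierInf J)
        ≤ 2 * (ε * ‖ξ‖) ^ γ * κ := by gcongr; exact min_le_left _ _
      _ = 2 * ε ^ γ * (κ * ‖ξ‖ ^ γ) := by
          rw [Real.mul_rpow hε0.le (norm_nonneg _)]; ring
      _ ≤ _ := by gcongr; exact hm ξ h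
  · calc min 2 ((ε * ‖ξ‖) ^ 2 / 2) * min κ (multiplierInf J)
        ≤ 2 * multiplierInf J := by
          gcongr
          · exact min_le_left _ _
          · exact min_le_right _ _
      _ ≤ 2 * 1 * multiplier J ξ := by
          rw [mul_one]; gcongr; exact hJ.multiplierInf_le h
      _ ≤ _ := by gcongr

theorem two_mul_dirichletForm (J z : EuclideanSpace ℝ (Fin N) → ℝ) :
    2 * dirichletForm J z =
      ∫⁻ x, ∫⁻ y, ENNReal.ofReal ((z x - z y) ^ 2) * ENNReal.ofReal (J (x - y)) := by
  rw [dirichletForm, ← mul_assoc, ENNReal.mul_inv_cancel (by norm_num) (by norm_num), one_mul]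
  simp only [ENNReal.ofReal_mul (sq_nonneg _)]

/-- The family of inequalities of Nash type behind the theorem. -/
theorem lintegral_sq_le_dirichletForm_add (hN : 1 ≤ N) (hJ : IsLevyKernel J) {γ κ r : ℝ}
    (hγ₀ : 0 < γ) (hγ₂ : γ ≤ 2) (hκ : 0 < κ)
    (hm : ∀ ξ : EuclideanSpace ℝ (Fin N), ‖ξ‖ ≤ 1 → κ * ‖ξ‖ ^ γ ≤ multiplier J ξ)
    (hr1 : 1 < r) (hr2 : r ≤ 2) {z : EuclideanSpace ℝ (Fin N) → ℝ} (hz : MemLp z 2 volume)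
    {ε : ℝ} (hε : 1 ≤ ε) :
    ∫⁻ x, ‖z x‖ₑ ^ 2 ≤
      ENNReal.ofReal (2 / min κ (multiplierInf J) * ε ^ γ) * dirichletForm J z +
      (∫⁻ x, ‖z x‖ₑ ^ r) ^ (2 / r) *
        volume (Metric.ball (0 : EuclideanSpace ℝ (Fin N)) ε) ^ (1 - 2 / r) := by
  have hμ := hJ.multiplierInf_pos hN
  have hl : 0 < min κ (multiplierInf J) := lt_min hκ hμ
  have hε0 : 0 < ε := by linarith
  have hr1' : 0 < r - 1 := by linarith
  have h1 := two_mul_lintegral_sq_le hz.1.aemeasurable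
    (measurable_ballKernel (E := EuclideanSpace ℝ (Fin N)) (ε := ε)).aemeasurable
    (lintegral_ballKernel hε0)
  have h2 := lintegral_lintegral_mul_mul_sub_le (f := fun x => ‖z x‖ₑ) hz.1.aemeasurable.enorm
    (measurable_ballKernel (E := EuclideanSpace ℝ (Fin N)) (ε := ε)).aemeasurable hr1 hr2
  have ht : 2 - 2 / r = 1 / (r / (2 * (r - 1))) := by field_simp
  rw [ht, lintegral_ballKernel_rpow hε0 (by positivity), ← ht,
    show 2 - 2 / r - 1 = 1 - 2 / r by ring] at h2
  have h3 := lintegral_sq_sub_mul_le_of_multiplier_le hz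
    (j := fun h => ENNReal.ofReal (J h)) (k := ballKernel _ ε)
    (hJ.aemeasurable hN).ennreal_ofReal measurable_ballKernel.aemeasurable
    (C := ENNReal.ofReal (2 / min κ (multiplierInf J) * ε ^ γ)) ENNReal.ofReal_ne_top
    (fun ξ => by
      refine (lintegral_one_sub_cos_mul_ballKernel_le hε0 ξ).trans ?_
      rw [hJ.lintegral_one_sub_cos_mul hN, ← ENNReal.ofReal_mul (by positivity)]
      exact ENNReal.ofReal_le_ofReal
        (min_two_sq_le_mul_multiplier hJ hγ₀ hγ₂ hκ hμ hm hε ξ))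
  rw [← two_mul_dirichletForm] at h3
  rw [← ENNReal.mul_le_mul_iff_right (a := 2) (by norm_num) (by norm_num)]
  refine h1.trans ?_
  rw [mul_add]
  refine add_le_add (h3.trans (by rw [mul_left_comm])) (mul_le_mul_right h2 _)

end LevyKernel

/-! ### Interpolation and the inequalities for real norms -/

theorem realLpNorm_nonneg {N : ℕ} (p : ℝ) (f : EuclideanSpace ℝ (Fin N) → ℝ) :
    0 ≤ realLpNorm p f := ENNReal.toReal_nonneg

theorem lintegral_enorm_rpow_eq {N : ℕ} {p : ℝ} (hp : 0 < p) {f : EuclideanSpace ℝ (Fin N) → ℝ}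
    (hf : MemLp f (ENNReal.ofReal p) volume) :
    ∫⁻ x, ‖f x‖ₑ ^ p = ENNReal.ofReal (realLpNorm p f ^ p) := by
  rw [← ENNReal.ofReal_rpow_of_nonneg (realLpNorm_nonneg p f) hp.le, realLpNorm,
    ENNReal.ofReal_toReal hf.2.ne, eLpNorm_eq_lintegral_rpow_enorm_toReal (by simpa using hp)
      ENNReal.ofReal_ne_top, ENNReal.toReal_ofReal hp.le, ← ENNReal.rpow_mul,
    one_div_mul_cancel hp.ne', ENNReal.rpow_one]

/-- Interpolation of `L^s` between `L^r` and `L²`. -/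
theorem realLpNorm_le_interpolation {N : ℕ} {r s : ℝ} (hr : 1 < r) (hrs : r < s) (hs : s ≤ 2)
    {z : EuclideanSpace ℝ (Fin N) → ℝ} (hz : MemLp z 2 volume)
    (hzr : MemLp z (ENNReal.ofReal r) volume) :
    realLpNorm s z ≤ realLpNorm r z ^ theta₂ r s * realLpNorm 2 z ^ (1 - theta₂ r s) := by
  have hr0 : 0 < r := by linarith
  have hs0 : 0 < s := by linarith
  have h2r : 0 < 2 - r := by linarith
  have hz2 : MemLp z (ENNReal.ofReal 2) volume := by simpa using hz
  have hp := realLpNorm_nonneg r z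
  have hq := realLpNorm_nonneg 2 z
  -- The weights that write `s = rα + 2β` as a convex combination of `r` and `2`.
  set α := (2 - s) / (2 - r) with hα
  set β := (s - r) / (2 - r) with hβ
  have hα0 : 0 ≤ α := div_nonneg (by linarith) h2r.le
  have hβ0 : 0 ≤ β := div_nonneg (by linarith) h2r.le
  have hαβ : α + β = 1 := by rw [hα, hβ]; field_simp; ring
  have hsum : r * α + 2 * β = s := by rw [hα, hβ]; field_simp; ring
  have H := ENNReal.lintegral_mul_norm_pow_le (hzr.1.aemeasurable.enorm.pow_const r)
    (hz.1.aemeasurable.enorm.pow_const (2 : ℝ)) hα0 hβ0 hαβ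
  rw [lintegral_enorm_rpow_eq hr0 hzr, lintegral_enorm_rpow_eq two_pos hz2,
    ENNReal.ofReal_rpow_of_nonneg (by positivity) hα0,
    ENNReal.ofReal_rpow_of_nonneg (by positivity) hβ0, ← ENNReal.ofReal_mul (by positivity),
    ← Real.rpow_mul hp, ← Real.rpow_mul hq] at H
  have e : ∀ x, (‖z x‖ₑ ^ r) ^ α * (‖z x‖ₑ ^ (2 : ℝ)) ^ β = ‖z x‖ₑ ^ s := fun x => by
    rw [← ENNReal.rpow_mul, ← ENNReal.rpow_mul,
      ← ENNReal.rpow_add_of_nonneg _ _ (by positivity) (by positivity), hsum]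
  simp only [e] at H
  have H' := ENNReal.rpow_le_rpow H (one_div_nonneg.2 hs0.le)
  rw [ENNReal.ofReal_rpow_of_nonneg (by positivity) (by positivity)] at H'
  have H'' := ENNReal.toReal_mono ENNReal.ofReal_ne_top H'
  rw [ENNReal.toReal_ofReal (by positivity), Real.mul_rpow (by positivity) (by positivity),
    ← Real.rpow_mul hp, ← Real.rpow_mul hq] at H''
  have e1 : r * α * (1 / s) = theta₂ r s := by rw [hα, theta₂]; field_simp
  have e2 : 2 * β * (1 / s) = 1 - theta₂ r s := by
    rw [← e1, eq_sub_iff_add_eq, ← add_mul, add_comm, hsum, mul_one_div_cancel hs0.ne']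
  rw [e1, e2] at H''
  refine le_trans (le_of_eq ?_) H''
  rw [realLpNorm, eLpNorm_eq_lintegral_rpow_enorm_toReal (by simpa using hs0)
    ENNReal.ofReal_ne_top, ENNReal.toReal_ofReal hs0.le]

theorem realLpNorm_two_sq_le {N : ℕ} (hN : 1 ≤ N) {J : EuclideanSpace ℝ (Fin N) → ℝ}
    (hJ : IsLevyKernel J) {γ κ r : ℝ} (hγ₀ : 0 < γ) (hγ₂ : γ ≤ 2) (hκ : 0 < κ)
    (hm : ∀ ξ : EuclideanSpace ℝ (Fin N), ‖ξ‖ ≤ 1 → κ * ‖ξ‖ ^ γ ≤ multiplier J ξ)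
    (hr1 : 1 < r) (hr2 : r ≤ 2) {z : EuclideanSpace ℝ (Fin N) → ℝ} (hz : MemEnergySpace J z)
    (hzr : MemLp z (ENNReal.ofReal r) volume) {ε : ℝ} (hε : 1 ≤ ε) :
    realLpNorm 2 z ^ 2 ≤
      2 / min κ (multiplierInf J) * ε ^ γ * (dirichletForm J z).toReal +
      (volume (Metric.ball (0 : EuclideanSpace ℝ (Fin N)) 1)).toReal ^ (1 - 2 / r) *
        ε ^ (-(N * (2 / r - 1))) * realLpNorm r z ^ 2 := by
  have : Nonempty (Fin N) := ⟨⟨0, hN⟩⟩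
  have hr0 : 0 < r := by linarith
  have hε0 : 0 < ε := by linarith
  have hl : 0 < min κ (multiplierInf J) := lt_min hκ (hJ.multiplierInf_pos hN)
  have hz2 : MemLp z (ENNReal.ofReal 2) volume := by simpa using hz.1
  have hp := realLpNorm_nonneg r z
  have hq := realLpNorm_nonneg 2 z
  have hv := Metric.measure_ball_pos (volume : Measure (EuclideanSpace ℝ (Fin N))) 0 one_pos
  have hv' := (measure_ball_lt_top (μ := (volume : Measure (EuclideanSpace ℝ (Fin N))))
    (x := 0) (r := 1)).ne
  have hV := ENNReal.toReal_pos hv.ne' hv'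
  have H := lintegral_sq_le_dirichletForm_add hN hJ hγ₀ hγ₂ hκ hm hr1 hr2 hz.1 hε
  have e2 : ∫⁻ x, ‖z x‖ₑ ^ 2 = ENNReal.ofReal (realLpNorm 2 z ^ 2) := by
    simpa using lintegral_enorm_rpow_eq two_pos hz2
  rw [e2, lintegral_enorm_rpow_eq hr0 hzr, Measure.addHaar_ball _ _ hε0.le, finrank_euclideanSpace,
    Fintype.card_fin, ← ENNReal.ofReal_toReal hz.2.ne, ← ENNReal.ofReal_toReal hv',
    ← ENNReal.ofReal_mul (by positivity), ENNReal.ofReal_rpow_of_nonneg (by positivity)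
    (by positivity), ← ENNReal.ofReal_mul (by positivity),
    ENNReal.ofReal_rpow_of_pos (by positivity),
    ← ENNReal.ofReal_mul (by positivity),
    ← ENNReal.ofReal_add (by positivity) (by positivity),
    ENNReal.ofReal_le_ofReal_iff (by positivity)] at H
  refine H.trans (le_of_eq ?_)
  congr 1
  rw [← Real.rpow_mul hp, mul_div_cancel₀ _ hr0.ne', Real.rpow_two,
    Real.mul_rpow (by positivity) hV.le, ← Real.rpow_natCast ε N, ← Real.rpow_mul hε0.le,
    show (N : ℝ) * (1 - 2 / r) = -(N * (2 / r - 1)) by ring]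
  ring

/-! ### Optimization in the radius, exponents and conclusion -/

/-- Optimization over `ε ≥ 1` of `q² ≤ c₂ ε^γ D + c₁ ε^(-a) p²`. -/
theorem rpow_le_or_le_of_forall {a γ c₁ c₂ p q D : ℝ} (ha : 0 < a) (hγ : 0 < γ) (hc₁ : 0 < c₁)
    (hc₂ : 0 < c₂) (hp : 0 < p) (hq : 0 ≤ q) (hD : 0 < D)
    (h : ∀ ε : ℝ, 1 ≤ ε → q ^ 2 ≤ c₂ * ε ^ γ * D + c₁ * ε ^ (-a) * p ^ 2) :
    (c₁ + c₂) ^ (-((a + γ) / a)) * (q ^ (2 * ((a + γ) / a)) * p ^ (-(2 * γ / a))) ≤ D ∨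
      (c₁ + c₂)⁻¹ * q ^ 2 ≤ D := by
  rcases le_or_gt (p ^ 2) D with hpD | hpD
  -- At `ε = 1`, `q² ≤ c₂ D + c₁ p² ≤ (c₁ + c₂) D`.
  · right
    have := h 1 le_rfl
    simp only [Real.one_rpow, mul_one] at this
    rw [inv_mul_le_iff₀ (by positivity)]
    nlinarith
  · left
    have haγ : 0 < a + γ := by positivity
    have hR : 1 ≤ p ^ 2 / D := (one_le_div hD).2 hpD.le
    have hR0 : 0 < p ^ 2 / D := by positivity
    -- This `ε` solves `ε^γ D = ε^(-a) p²`; it is at least 1 because `D < p²`.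
    have h1 := h ((p ^ 2 / D) ^ (1 / (a + γ))) (Real.one_le_rpow hR (by positivity))
    rw [← Real.rpow_mul hR0.le, ← Real.rpow_mul hR0.le] at h1
    have e1 : (p ^ 2 / D) ^ (1 / (a + γ) * γ) * D =
        p ^ (2 * γ / (a + γ)) * D ^ (a / (a + γ)) := by
      rw [Real.div_rpow (by positivity) hD.le, ← Real.rpow_two, ← Real.rpow_mul hp.le,
        div_mul_eq_mul_div, mul_div_assoc]
      congr 1
      · congr 1; ring
      · nth_rw 1 [← Real.rpow_one D]
        rw [← Real.rpow_sub hD]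
        congr 1; field_simp; ring
    have e2 : (p ^ 2 / D) ^ (1 / (a + γ) * -a) * p ^ 2 =
        p ^ (2 * γ / (a + γ)) * D ^ (a / (a + γ)) := by
      rw [Real.div_rpow (by positivity) hD.le, ← Real.rpow_two, ← Real.rpow_mul hp.le,
        div_mul_eq_mul_div, ← Real.rpow_add hp, div_eq_mul_inv, ← Real.rpow_neg hD.le]
      congr 1
      · congr 1; field_simp; ring
      · congr 1; field_simp
    rw [mul_assoc, e1, mul_assoc, e2, ← add_mul] at h1
    have h2 := Real.rpow_le_rpow (by positivity) h1 (by positivity : 0 ≤ (a + γ) / a)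
    rw [Real.mul_rpow (by positivity) (by positivity),
      Real.mul_rpow (by positivity) (by positivity), ← Real.rpow_mul hD.le, ← Real.rpow_mul hp.le,
      ← Real.rpow_two, ← Real.rpow_mul hq] at h2
    have e3 : a / (a + γ) * ((a + γ) / a) = 1 := by field_simp
    have e4 : 2 * γ / (a + γ) * ((a + γ) / a) = 2 * γ / a := by field_simp
    rw [e3, e4, Real.rpow_one] at h2
    rw [Real.rpow_neg (by positivity), Real.rpow_neg hp.le, inv_mul_le_iff₀ (by positivity),
      mul_inv_le_iff₀ (by positivity)]
    calc _ ≤ _ := h2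
      _ = _ := by rw [add_comm c₂]; ring

section exponents

variable {N : ℕ} {γ r s : ℝ}

/-- The factored forms of `1 - θ₂` and `1 - θ₁` show their positivity and their ratio `(a + γ)/a`.
-/
theorem one_sub_theta₂ (hr : 1 < r) (hrs : r < s) (hs : s ≤ 2) :
    1 - theta₂ r s = 2 * (s - r) / (s * (2 - r)) := by
  have h1 : 0 < s := by linarith
  have h2 : 0 < 2 - r := by linarith
  rw [theta₂]; field_simp; ring

theorem one_sub_theta₁ (hN : 1 ≤ N) (hγ₀ : 0 < γ) (hr : 1 < r) (hrs : r < s) (hs : s ≤ 2) :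
    1 - theta₁ N γ r s = 2 * N * (s - r) / (s * (N * (2 - r) + γ * r)) := by
  have h1 : 0 < s := by linarith
  have h0 : 0 < r := by linarith
  have h2 : 0 < 2 - r := by linarith
  have h3 : (0 : ℝ) < N := by exact_mod_cast hN
  have h4 : 0 < N * (2 - r) + γ * r := by positivity
  rw [theta₁]; field_simp; ring

end exponents

/-- Passage from the `L²` norm `q` to the `L^s` norm `σ`. -/
theorem rpow_interpolation_le {p q σ θ θ' : ℝ} (hp : 0 < p) (hq : 0 ≤ q) (hσ0 : 0 ≤ σ)
    (hθ : θ < 1) (hσ : σ ≤ p ^ θ' * q ^ (1 - θ')) :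
    (σ * p ^ (-θ)) ^ (2 / (1 - θ)) ≤
      q ^ (2 * ((1 - θ') / (1 - θ))) * p ^ (2 * ((θ' - θ) / (1 - θ))) := by
  have hθ' : 0 < 1 - θ := by linarith
  calc (σ * p ^ (-θ)) ^ (2 / (1 - θ))
      ≤ (p ^ θ' * q ^ (1 - θ') * p ^ (-θ)) ^ (2 / (1 - θ)) := by gcongr
    _ = (q ^ (1 - θ') * p ^ (θ' - θ)) ^ (2 / (1 - θ)) := by
        rw [sub_eq_add_neg θ', Real.rpow_add hp]; ring_nf
    _ = _ := by
        rw [Real.mul_rpow (by positivity) (by positivity), ← Real.rpow_mul hq, ← Real.rpow_mul hp.le]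
        congr 2 <;> ring

/-- The constant is `C κ μ`, where `C` depends only on `N, γ, r, s`, where `κ` is the constant in
the lower bound of the multiplier on `|ξ| ≤ 1`, and `μ > 0` is its infimum on `|ξ| ≥ 1`. -/
theorem mainTheorem3 (N : ℕ) (hN : 1 ≤ N) (γ r s : ℝ) (hγ₀ : 0 < γ) (hγ₂ : γ ≤ 2)
    (hr : 1 < r) (hrs : r < s) (hs : s ≤ 2) :
    ∃ C : ℝ → ℝ → ℝ, (∀ κ μ : ℝ, 0 < κ → 0 < μ → 0 < C κ μ) ∧
      ∀ J : EuclideanSpace ℝ (Fin N) → ℝ, IsLevyKernel J →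
      ∀ κ : ℝ, 0 < κ →
        (∀ ξ : EuclideanSpace ℝ (Fin N), ‖ξ‖ ≤ 1 → κ * ‖ξ‖ ^ γ ≤ multiplier J ξ) →
        0 < multiplierInf J ∧
        ∀ z : EuclideanSpace ℝ (Fin N) → ℝ,
          MemEnergySpace J z → MemLp z (ENNReal.ofReal r) volume →
          ENNReal.ofReal (C κ (multiplierInf J) *
            min
              ((realLpNorm s z * realLpNorm r z ^ (-theta₁ N γ r s)) ^ (2 / (1 - theta₁ N γ r s)))
              ((realLpNorm s z * realLpNorm r z ^ (-theta₂ r s)) ^ (2 / (1 - theta₂ r s))))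
            ≤ dirichletForm J z := by
  have hr0 : 0 < r := by linarith
  have hs0 : 0 < s := by linarith
  have h2r : 0 < 2 - r := by linarith
  have hsr : 0 < s - r := by linarith
  have hN0 : (0 : ℝ) < N := by exact_mod_cast hN
  set a : ℝ := N * (2 / r - 1) with ha
  have haeq : a = N * (2 - r) / r := by rw [ha]; field_simp
  have ha0 : 0 < a := by rw [haeq]; positivity
  set b := (a + γ) / a with hb
  set V := (volume (Metric.ball (0 : EuclideanSpace ℝ (Fin N)) 1)).toReal with hVdef
  have hV : 0 < V := ENNReal.toReal_pos (Metric.measure_ball_pos volume 0 one_pos).ne'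
    measure_ball_lt_top.ne
  set c₁ := V ^ (1 - 2 / r) with hc₁
  have hc₁0 : 0 < c₁ := by positivity
  have hD1 : 0 < N * (2 - r) + γ * r := by positivity
  have h1 : 0 < 1 - theta₁ N γ r s := by
    rw [one_sub_theta₁ hN hγ₀ hr hrs hs]; positivity
  have h2 : 0 < 1 - theta₂ r s := by
    rw [one_sub_theta₂ hr hrs hs]; positivity
  -- `hb1` and `hb2` match the exponents of `q` and `p` left by interpolation with those of the
  -- first case of the optimization.
  have hb1 : (1 - theta₂ r s) / (1 - theta₁ N γ r s) = b := by
    rw [one_sub_theta₁ hN hγ₀ hr hrs hs, one_sub_theta₂ hr hrs hs, hb, haeq]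
    field_simp
  have hb2 : 2 * ((theta₂ r s - theta₁ N γ r s) / (1 - theta₁ N γ r s)) = -(2 * γ / a) := by
    rw [show theta₂ r s - theta₁ N γ r s = (1 - theta₁ N γ r s) - (1 - theta₂ r s) by ring,
      sub_div, hb1, div_self h1.ne', hb]
    field_simp; ring
  refine ⟨fun κ μ => min ((c₁ + 2 / min κ μ) ^ (-b)) (c₁ + 2 / min κ μ)⁻¹,
    fun κ μ hκ hμ => ?_, fun J hJ κ hκ hm => ?_⟩
  · have : 0 < min κ μ := lt_min hκ hμ
    positivity
  have hμ := hJ.multiplierInf_pos hN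
  refine ⟨hμ, fun z hz hzr => ?_⟩
  have hl : 0 < min κ (multiplierInf J) := lt_min hκ hμ
  set c₂ := 2 / min κ (multiplierInf J) with hc₂
  have hc₂0 : 0 < c₂ := by positivity
  have hp := realLpNorm_nonneg r z
  have hq := realLpNorm_nonneg 2 z
  have hσ0 := realLpNorm_nonneg s z
  have hσ := realLpNorm_le_interpolation hr hrs hs hz.1 hzr
  have hnash := fun ε hε => realLpNorm_two_sq_le hN hJ hγ₀ hγ₂ hκ hm hr (by linarith) hz hzr
    (ε := ε) hε
  set p := realLpNorm r z
  set q := realLpNorm 2 z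
  set σ := realLpNorm s z
  refine ENNReal.ofReal_le_of_le_toReal ?_
  dsimp only
  rcases hp.eq_or_lt with hp0 | hp0
  -- Here `z = 0` a.e., and the factor `σ = 0` annihilates the product whatever the value of `0 ^
  -- (-θ)`.
  · have hz0 : σ = 0 := by
      have hzero : eLpNorm z (ENNReal.ofReal r) volume = 0 :=
        ((ENNReal.toReal_eq_zero_iff _).1 hp0.symm).resolve_right hzr.2.ne
      rw [eLpNorm_eq_zero_iff hzr.1 (by simpa using hr0)] at hzero
      simp [σ, realLpNorm, eLpNorm_congr_ae hzero]
    rw [hz0, zero_mul, zero_mul, Real.zero_rpow (by positivity), Real.zero_rpow (by positivity),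
      min_self, mul_zero]
    exact ENNReal.toReal_nonneg
  have t1 := rpow_interpolation_le hp0 hq hσ0 (by linarith : theta₁ N γ r s < 1) hσ
  have t2 := rpow_interpolation_le hp0 hq hσ0 (by linarith : theta₂ r s < 1) hσ
  rw [hb1, hb2] at t1
  -- With both parameters equal to `θ₂` the power of `p` disappears and only `q²` remains.
  rw [div_self h2.ne', sub_self, zero_div, mul_zero, Real.rpow_zero, mul_one, mul_one,
    Real.rpow_two] at t2
  -- The optimization divides by `D`, so it is applied to every `D` above the energy, which might
  -- vanish.
  refine le_of_forall_gt_imp_ge_of_dense fun D hD => ?_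
  have hD0 : 0 < D := ENNReal.toReal_nonneg.trans_lt hD
  rcases rpow_le_or_le_of_forall ha0 hγ₀ hc₁0 hc₂0 hp0 hq hD0 (fun ε hε =>
    (hnash ε hε).trans (by
      have : 0 ≤ ε := by linarith
      gcongr)) with h | h
  · refine le_trans (mul_le_mul (min_le_left _ _) ((min_le_left _ _).trans t1) (by positivity)
      (by positivity)) h
  · refine le_trans (mul_le_mul (min_le_right _ _) ((min_le_right _ _).trans t2) (by positivity)
      (by positivity)) h
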